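/- Let $V$ be a finite set with $|V|\ge 3$, let $G\le \mathrm{Sym}(V)$ be a transitive permutation group, let $n\ge 2$, and let $H\le S_n=\mathrm{Sym}(\{1,\dots,n\})$ be regular (transitive with trivial point stabilizers). Let $G\wr H\le \mathrm{Sym}(V\times\{1,\dots,n\})$ be the wreath product, i.e. the group of all permutations $(a,i)\mapsto (g_i(a),h(i))$ with $g_1,\dots,g_n\in G$ and $h\in H$. For a permutation group $K\le\mathrm{Sym}(\Omega)$, $\Omega$ finite, a subset $I\subseteq K$ is called intersecting if for all $g,h\in I$ there is $\omega\in \Omega$ with $g(\omega)=h(\omega)$; $K$ has the strict-EKR-property if every intersecting set of maximum size in $K$ is a coset of a point stabilizer. The derangement graph $\Gamma_K$ has vertex set $K$, with $g\ne h$ adjacent if and only if $gh^{-1}$ has no fixed point. A finite graph $\Gamma$ with vertex set $V(\Gamma)$ and independence number $\alpha(\Gamma)$ is IS-primitive if there is no nonempty independent set $A$ with $|A|<\alpha(\Gamma)$ and $|A|/|N[A]|=\alpha(\Gamma)/|V(\Gamma)|$, where $N[A]$ is the closed neighbourhood of $A$ (the vertices of $A$ together with all their neighbours). Then $G\wr H$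 has the strict-EKR-property if and only if $G$ has the strict-EKR-property and $\Gamma_G$ is IS-primitive. -/

import Mathlib

namespace PermEKR

open Equiv

/-- The derangement graph of a permutation group `G`: the vertices are the elements of `G`, and
distinct `g`, `h` are adjacent iff `g * h⁻¹` is a derangement. (Distinctness is automatic when
`V` is nonempty.) -/
def derangementGraph {V : Type*} (G : Subgroup (Perm V)) : SimpleGraph G where
  Adj g h := g ≠ h ∧ ((g * h⁻¹ : G) : Perm V) ∈ derangements V
  symm := ⟨by
    rintro g h ⟨hne, hd⟩
    refine ⟨hne.symm, fun v hv => hd v ?_⟩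
    have h1 : ((g * h⁻¹ : G) : Perm V) = ((h * g⁻¹ : G) : Perm V)⁻¹ := by simp
    rw [h1, Perm.inv_eq_iff_eq]
    exact hv.symm⟩
  loopless := ⟨fun _ h => h.1 rfl⟩

/-- A set of elements of `G` is intersecting if any two of its elements agree at some point. -/
def IsIntersecting {V : Type*} (G : Subgroup (Perm V)) (I : Finset G) : Prop :=
  ∀ g ∈ I, ∀ h ∈ I, ∃ v : V, (g : Perm V) v = (h : Perm V) v

/-- An intersecting set of maximum size. -/
def IsMaximumIntersecting {V : Type*} (G : Subgroup (Perm V)) (I : Finset G) : Prop :=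
  IsIntersecting G I ∧ ∀ J : Finset G, IsIntersecting G J → J.card ≤ I.card

/-- `I` is a coset of a point stabilizer. Left cosets are used; since
`g G_v = G_{g v} g`, right cosets of point stabilizers give the same family of sets. -/
def IsStabilizerCoset {V : Type*} (G : Subgroup (Perm V)) (I : Finset G) : Prop :=
  ∃ (g : G) (v : V), (I : Set G) = {x : G | ∃ s ∈ MulAction.stabilizer G v, x = g * s}

/-- The strict Erdős-Ko-Rado property: every maximum intersecting set is a coset of a point
stabilizer. -/
def StrictEKR {V : Type*} (G : Subgroup (Perm V)) : Prop :=
  ∀ I : Finset G, IsMaximumIntersecting G I → IsStabilizerCoset G I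

/-- The closed neighbourhood `N[A]` of a set of vertices. -/
def closedNeighborhood {W : Type*} (Γ : SimpleGraph W) (A : Set W) : Set W :=
  A ∪ {w | ∃ a ∈ A, Γ.Adj a w}

/-- A (finite) graph is IS-primitive if no nonempty independent set `A` that is not of maximum
size satisfies `|A| / |N[A]| = α(Γ) / |V(Γ)|`. -/
def ISPrimitive {W : Type*} (Γ : SimpleGraph W) : Prop :=
  ¬ ∃ A : Finset W, A.Nonempty ∧ Γ.IsIndepSet (A : Set W) ∧ A.card < Γ.indepNum ∧
    (A.card : ℚ) / ((closedNeighborhood Γ (A : Set W)).ncard : ℚ) =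
      (Γ.indepNum : ℚ) / (Nat.card W : ℚ)

/-- A permutation group is regular if it is transitive and all point stabilizers are trivial. -/
def IsRegularPermGroup {N : Type*} (H : Subgroup (Perm N)) : Prop :=
  MulAction.IsPretransitive H N ∧ ∀ i : N, MulAction.stabilizer H i = ⊥

/-- The permutation `(a, i) ↦ (g_i a, h i)` of `V × N`. -/
def wreathPerm {V N : Type*} (g : N → Perm V) (h : Perm N) : Perm (V × N) where
  toFun p := (g p.2 p.1, h p.2)
  invFun p := ((g (h⁻¹ p.2))⁻¹ p.1, h⁻¹ p.2)
  left_inv p := by simp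
  right_inv p := by simp

/-- The wreath product `G ≀ H` as a permutation group on `V × N`. -/
def wreath {V N : Type*} (G : Subgroup (Perm V)) (H : Subgroup (Perm N)) :
    Subgroup (Perm (V × N)) where
  carrier := {σ | ∃ (g : N → Perm V) (h : Perm N), (∀ i, g i ∈ G) ∧ h ∈ H ∧ σ = wreathPerm g h}
  one_mem' := ⟨fun _ => 1, 1, fun _ => G.one_mem, H.one_mem, by ext p <;> simp [wreathPerm]⟩
  mul_mem' := by
    rintro _ _ ⟨g, h, hg, hh, rfl⟩ ⟨g', h', hg', hh', rfl⟩
    exact ⟨fun i => g (h' i) * g' i, h * h', fun i => G.mul_mem (hg _) (hg' _),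
      H.mul_mem hh hh', by ext p <;> simp [wreathPerm]⟩
  inv_mem' := by
    rintro _ ⟨g, h, hg, hh, rfl⟩
    refine ⟨fun i => (g (h⁻¹ i))⁻¹, h⁻¹, fun i => G.inv_mem (hg _), H.inv_mem hh, ?_⟩
    rw [inv_eq_iff_mul_eq_one]
    ext p <;> simp [wreathPerm]

end PermEKR

/-! Since `H` is regular, two elements of the wreath product that agree at a point have the same
component in `H`. Hence an intersecting set lies over a single `h`, and the claim becomes one about
the `n`-fold direct power of the derangement graph: strict EKR for `wreath G H` is equivalent to
`PowStrictEKR G n` (`strictEKR_wreath_iff`).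

Put `m = |V|`. Strict EKR makes the independence ratio of the derangement graph `1 / m`. In a Cayley
graph of ratio `1 / m`, averaging over translates gives `m |S| ≤ |N[S]|` for independent `S`
(`TightCayley.le_card_nbhd`). If equality holds, `S` can replace `T ∩ N[S]` in any maximum
independent set `T` without changing its size (`TightCayley.exchange`).

If the graph is IS-primitive, splitting an independent set of a product into fibrewise isolated and
linked points shows that maximum ones come from one factor (`tight_prod_cases`). Primitivity passes
to products when `m ≥ 3` (`Primitive.prod`), so induction treats all powers. Conversely, if `m |A| =
|N[A]|` and `A` is not of maximum size, exchanging the cylinder over `A` in one coordinate into a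
maximum cylinder in another gives a maximum independent set that depends on both coordinates
(`PowStrictEKR.primitive`). -/

namespace PermEKR

open Finset Equiv
open scoped Classical

set_option linter.unusedSectionVars false

/-! ### Cayley graphs with independence ratio `1 / m`: averaging and exchange. -/

section Cayley

variable {K : Type*} [Fintype K]

/-- No two elements of `S` are related by `r`. -/
def Indep (r : K → K → Prop) (S : Finset K) : Prop := ∀ x ∈ S, ∀ y ∈ S, ¬ r x y

/-- The closed neighbourhood of a finite set with respect to a relation. -/
noncomputable def nbhd (r : K → K → Prop) (S : Finset K) : Finset K :=
  univ.filter fun w => w ∈ S ∨ ∃ a ∈ S, r a w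

@[simp] lemma mem_nbhd {r : K → K → Prop} {S : Finset K} {w : K} :
    w ∈ nbhd r S ↔ w ∈ S ∨ ∃ a ∈ S, r a w := by simp [nbhd]

lemma subset_nbhd {r : K → K → Prop} {S : Finset K} : S ⊆ nbhd r S :=
  fun _ h => mem_nbhd.2 (Or.inl h)

/-- A symmetric relation on a finite group, invariant under right translations, whose largest
independent sets have size `|K| / m`. -/
structure TightCayley [Group K] (m : ℕ) (r : K → K → Prop) : Prop where
  symm : ∀ x y, r x y → r y x
  inv : ∀ x y g, r x y → r (x * g) (y * g)
  bound : ∀ S, Indep r S → m * #S ≤ Fintype.card K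
  tight : ∃ T, Indep r T ∧ m * #T = Fintype.card K

/-- The only nonempty independent sets with `|S| / |N[S]| = 1 / m` are those of size `|K| / m`. -/
def Primitive (m : ℕ) (r : K → K → Prop) : Prop :=
  ∀ S, Indep r S → S.Nonempty → m * #S = #(nbhd r S) → m * #S = Fintype.card K

lemma Indep.union_sdiff [DecidableEq K] {r : K → K → Prop} (hs : ∀ x y, r x y → r y x) {S T : Finset K}
    (hS : Indep r S) (hT : Indep r T) : Indep r (S ∪ (T \ nbhd r S)) := by
  intro x hx y hy hxy
  simp only [mem_union, mem_sdiff, mem_nbhd, not_or, not_exists, not_and] at hx hy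
  rcases hx with hx | ⟨hx, hx1, hx2⟩ <;> rcases hy with hy | ⟨hy, hy1, hy2⟩
  · exact hS x hx y hy hxy
  · exact hy2 x hx hxy
  · exact hx2 y hy (hs _ _ hxy)
  · exact hT x hx y hy hxy

lemma card_union_sdiff_nbhd [DecidableEq K] {r : K → K → Prop} (S T : Finset K) :
    #(S ∪ (T \ nbhd r S)) + #(T ∩ nbhd r S) = #S + #T := by
  have h : Disjoint S (T \ nbhd r S) :=
    disjoint_of_subset_left subset_nbhd disjoint_sdiff
  rw [card_union_of_disjoint h, add_assoc, card_sdiff_add_card_inter]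

/-- The translate of a set by a group element, on the right. -/
noncomputable def translate [Group K] (T : Finset K) (g : K) : Finset K :=
  univ.filter fun x => x * g⁻¹ ∈ T

@[simp] lemma mem_translate [Group K] {T : Finset K} {g x : K} :
    x ∈ translate T g ↔ x * g⁻¹ ∈ T := by simp [translate]

lemma card_translate [Group K] (T : Finset K) (g : K) : #(translate T g) = #T := by
  have : translate T g = T.map (Equiv.mulRight g).toEmbedding := by
    ext x
    simp only [mem_translate, mem_map, Equiv.coe_toEmbedding, Equiv.coe_mulRight]
    constructor
    · intro h; exact ⟨_, h, by simp⟩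
    · rintro ⟨a, ha, rfl⟩; simpa using ha
  rw [this, card_map]

/-- Double counting: for each `b ∈ B` and `t ∈ T` exactly one `g` satisfies `b * g⁻¹ = t`. -/
lemma sum_card_translate_inter [DecidableEq K] [Group K] (T B : Finset K) :
    ∑ g : K, #(translate T g ∩ B) = #T * #B := by
  have h1 : ∀ g : K, #(translate T g ∩ B) = ∑ b ∈ B, if b * g⁻¹ ∈ T then 1 else 0 := by
    intro g
    rw [← card_filter]
    congr 1
    ext x
    simp [and_comm]
  simp_rw [h1]
  rw [sum_comm]
  have h2 : ∀ b ∈ B, (∑ g : K, if b * g⁻¹ ∈ T then 1 else 0) = #T := by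
    intro b _
    rw [← card_filter]
    refine card_bij' (fun g _ => b * g⁻¹) (fun t _ => t⁻¹ * b) ?_ ?_ ?_ ?_ <;> simp
  rw [sum_congr rfl h2]
  simp [mul_comm]

namespace TightCayley

variable [Group K] {m : ℕ} {r : K → K → Prop}

lemma indep_translate (h : TightCayley m r) {T : Finset K} (hT : Indep r T) (g : K) :
    Indep r (translate T g) := fun _ hx _ hy hxy =>
  hT _ (mem_translate.1 hx) _ (mem_translate.1 hy) (h.inv _ _ _ hxy)

lemma m_pos (h : TightCayley m r) : 0 < m := by
  obtain ⟨T, _, h2⟩ := h.tight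
  have : 0 < Fintype.card K := Fintype.card_pos
  exact Nat.pos_of_mul_pos_right (h2 ▸ this)

/-- Otherwise replacing `T ∩ N[S]` by `S` would enlarge the maximum independent set `T`. -/
lemma card_le_inter [DecidableEq K] (h : TightCayley m r) {S T : Finset K} (hS : Indep r S) (hT : Indep r T)
    (hTc : m * #T = Fintype.card K) : #S ≤ #(T ∩ nbhd r S) := by
  have h1 := h.bound _ (hS.union_sdiff h.symm hT)
  have h2 := card_union_sdiff_nbhd (r := r) S T
  rw [← hTc] at h1
  have := Nat.le_of_mul_le_mul_left h1 h.m_pos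
  omega

/-- Sum `card_le_inter` over all translates of one maximum independent set. -/
lemma le_card_nbhd (h : TightCayley m r) {S : Finset K} (hS : Indep r S) :
    m * #S ≤ #(nbhd r S) := by
  obtain ⟨T, hT, hTc⟩ := h.tight
  have h1 : ∑ _g : K, #S ≤ ∑ g : K, #(translate T g ∩ nbhd r S) :=
    sum_le_sum fun g _ => h.card_le_inter hS (h.indep_translate hT g)
      (by rw [card_translate, hTc])
  rw [sum_card_translate_inter, sum_const, card_univ, smul_eq_mul, ← hTc] at h1
  have hTp : 0 < #T := by
    have : 0 < Fintype.card K := Fintype.card_pos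
    exact Nat.pos_of_mul_pos_left (hTc ▸ this)
  refine Nat.le_of_mul_le_mul_left ?_ hTp
  linarith

/-- Equality in the averaged bound forces equality for every translate of `T`, in particular for `T`
itself. -/
lemma exchange [DecidableEq K] (h : TightCayley m r) {S T : Finset K} (hS : Indep r S)
    (hSc : m * #S = #(nbhd r S)) (hT : Indep r T) (hTc : m * #T = Fintype.card K) :
    m * #(S ∪ (T \ nbhd r S)) = Fintype.card K := by
  have hle : ∀ g ∈ (univ : Finset K), #S ≤ #(translate T g ∩ nbhd r S) :=
    fun g _ => h.card_le_inter hS (h.indep_translate hT g) (by rw [card_translate, hTc])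
  have hsum : ∑ _g : K, #S = ∑ g : K, #(translate T g ∩ nbhd r S) := by
    rw [sum_card_translate_inter, sum_const, card_univ, smul_eq_mul, ← hTc, ← hSc]
    ring
  have h1 := (sum_eq_sum_iff_of_le hle).1 hsum 1 (mem_univ _)
  have h3 : translate T 1 = T := by ext; simp
  rw [h3] at h1
  have h2 := card_union_sdiff_nbhd (r := r) S T
  rw [← hTc, show #(S ∪ (T \ nbhd r S)) = #T by omega]

/-- Primitivity implies connectedness. For a union of components `C`, the bounds for `T ∩ C` and `T
∩ Cᶜ` add up to an equality, so `T ∩ C` attains the ratio `1 / m` and must have maximum size. -/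
lemma eq_univ_of_closed (h : TightCayley m r) (hp : Primitive m r) (C : Finset K)
    (hC : ∀ x y, r x y → x ∈ C → y ∈ C) (hne : C.Nonempty) : C = univ := by
  obtain ⟨T, hT, hTc⟩ := h.tight
  have hi : ∀ D : Finset K, Indep r (T ∩ D) := fun D x hx y hy =>
    hT x (mem_inter.1 hx).1 y (mem_inter.1 hy).1
  have hsub : ∀ D : Finset K, (∀ x y, r x y → x ∈ D → y ∈ D) → nbhd r (T ∩ D) ⊆ D := by
    intro D hD w hw
    rcases mem_nbhd.1 hw with hw | ⟨a, ha, haw⟩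
    · exact (mem_inter.1 hw).2
    · exact hD _ _ haw (mem_inter.1 ha).2
  have hC' : ∀ x y, r x y → x ∈ Cᶜ → y ∈ Cᶜ := by
    intro x y hxy hx
    rw [mem_compl] at hx ⊢
    exact fun hy => hx (hC _ _ (h.symm _ _ hxy) hy)
  have a1 := h.le_card_nbhd (hi C)
  have a2 := h.le_card_nbhd (hi Cᶜ)
  have b1 := card_le_card (hsub C hC)
  have b2 := card_le_card (hsub Cᶜ hC')
  have c1 := card_add_card_compl C
  have c2 : #(T ∩ C) + #(T ∩ Cᶜ) = #T := by
    rw [← card_inter_add_card_sdiff T C, sdiff_eq_inter_compl]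
  have c3 : m * #(T ∩ C) + m * #(T ∩ Cᶜ) = m * #T := by rw [← c2, mul_add]
  have hCpos := hne.card_pos
  have e1 : m * #(T ∩ C) = #C := by omega
  have hne' : (T ∩ C).Nonempty := by
    rw [← card_pos]
    exact Nat.pos_of_mul_pos_left (e1 ▸ hCpos)
  have := hp _ (hi C) hne' (by omega)
  exact (card_eq_iff_eq_univ C).1 (by omega)

lemma nbhd_eq_univ (h : TightCayley m r) {T : Finset K} (hT : Indep r T)
    (hTc : m * #T = Fintype.card K) : nbhd r T = univ := by
  have h1 := h.le_card_nbhd hT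
  exact (card_eq_iff_eq_univ _).1 (le_antisymm (card_le_univ _) (hTc ▸ h1))

end TightCayley

end Cayley

/-! ### Independent sets in a direct product of two such graphs. -/

section Product

variable {X Y : Type*} [Fintype X] [Fintype Y]

/-- The direct product of two relations. -/
def prodRel (r : X → X → Prop) (s : Y → Y → Prop) (p q : X × Y) : Prop :=
  r p.1 q.1 ∧ s p.2 q.2

/-- The points of the fibre of `S` over `x` that are isolated in that fibre. -/
noncomputable def isolatedPart (s : Y → Y → Prop) (S : Finset (X × Y)) (x : X) : Finset Y :=
  univ.filter fun y => (x, y) ∈ S ∧ ∀ y', s y y' → (x, y') ∉ S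

/-- The points `x` for which `(x, y)` is not isolated in its fibre. -/
noncomputable def linkedPart (s : Y → Y → Prop) (S : Finset (X × Y)) (y : Y) : Finset X :=
  univ.filter fun x => (x, y) ∈ S ∧ ∃ y', s y y' ∧ (x, y') ∈ S

@[simp] lemma mem_isolatedPart {s : Y → Y → Prop} {S : Finset (X × Y)} {x : X} {y : Y} :
    y ∈ isolatedPart s S x ↔ (x, y) ∈ S ∧ ∀ y', s y y' → (x, y') ∉ S := by simp [isolatedPart]

@[simp] lemma mem_linkedPart {s : Y → Y → Prop} {S : Finset (X × Y)} {x : X} {y : Y} :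
    x ∈ linkedPart s S y ↔ (x, y) ∈ S ∧ ∃ y', s y y' ∧ (x, y') ∈ S := by simp [linkedPart]

lemma card_filter_snd (F : X → Finset Y) :
    #(univ.filter fun p : X × Y => p.2 ∈ F p.1) = ∑ x, #(F x) := by
  rw [card_filter, Fintype.sum_prod_type]
  refine sum_congr rfl fun x _ => ?_
  rw [← card_filter]
  simp

lemma card_filter_fst (F : Y → Finset X) :
    #(univ.filter fun p : X × Y => p.1 ∈ F p.2) = ∑ y, #(F y) := by
  rw [card_filter, Fintype.sum_prod_type_right]
  refine sum_congr rfl fun x _ => ?_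
  rw [← card_filter]
  simp

lemma card_eq_isolated_add_linked (s : Y → Y → Prop) (S : Finset (X × Y)) :
    #S = ∑ x, #(isolatedPart s S x) + ∑ y, #(linkedPart s S y) := by
  rw [← card_filter_snd, ← card_filter_fst, ← card_union_of_disjoint]
  · congr 1
    ext ⟨x, y⟩
    simp only [mem_union, mem_filter, mem_univ, true_and, mem_isolatedPart, mem_linkedPart]
    constructor
    · intro h
      by_cases h' : ∃ y', s y y' ∧ (x, y') ∈ S
      · exact Or.inr ⟨h, h'⟩
      · push Not at h'
        exact Or.inl ⟨h, h'⟩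
    · rintro (h | h) <;> exact h.1
  · rw [disjoint_left]
    rintro ⟨x, y⟩ h1 h2
    simp only [mem_filter, mem_univ, true_and, mem_isolatedPart, mem_linkedPart] at h1 h2
    obtain ⟨y', hy, hm⟩ := h2.2
    exact h1.2 y' hy hm

lemma indep_isolatedPart {s : Y → Y → Prop} {S : Finset (X × Y)} (x : X) :
    Indep s (isolatedPart s S x) := fun _ hy y' hy' hs =>
  (mem_isolatedPart.1 hy).2 y' hs (mem_isolatedPart.1 hy').1

/-- If `x` and `x'` were adjacent, the fibre neighbour `y'` witnessing that `(x', y)` is linked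
would give an edge from `(x, y)` to `(x', y')` inside `S`. -/
lemma indep_linkedPart {r : X → X → Prop} {s : Y → Y → Prop} {S : Finset (X × Y)}
    (hS : Indep (prodRel r s) S) (y : Y) : Indep r (linkedPart s S y) := by
  intro x hx x' hx' hr
  obtain ⟨y', hy', hm⟩ := (mem_linkedPart.1 hx').2
  exact hS _ (mem_linkedPart.1 hx).1 _ hm ⟨hr, hy'⟩

lemma disjoint_nbhd_parts {r : X → X → Prop} {s : Y → Y → Prop}
    (hs : ∀ x y, s x y → s y x) {S : Finset (X × Y)}
    (hS : Indep (prodRel r s) S) (x : X) (y : Y) (h1 : y ∈ nbhd s (isolatedPart s S x))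
    (h2 : x ∈ nbhd r (linkedPart s S y)) : False := by
  simp only [mem_nbhd, mem_isolatedPart, mem_linkedPart] at h1 h2
  rcases h1 with ⟨h1, h1'⟩ | ⟨a, ⟨ha, ha'⟩, hay⟩ <;>
    rcases h2 with ⟨h2, y', hy', hm⟩ | ⟨x', ⟨hx', y', hy', hm⟩, hxx⟩
  · exact h1' _ hy' hm
  · exact hS _ hm _ h1 ⟨hxx, hs _ _ hy'⟩
  · exact ha' _ hay h2
  · exact hS _ hx' _ ha ⟨hxx, hs _ _ hay⟩

variable [Group X] [Group Y] {m : ℕ} {r : X → X → Prop} {s : Y → Y → Prop}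

lemma sum_nbhd_parts_le (hY : TightCayley m s) {S : Finset (X × Y)}
    (hS : Indep (prodRel r s) S) :
    ∑ x, #(nbhd s (isolatedPart s S x)) + ∑ y, #(nbhd r (linkedPart s S y)) ≤
      Fintype.card (X × Y) := by
  rw [← card_filter_snd, ← card_filter_fst, ← card_union_of_disjoint]
  · exact card_le_univ _
  · rw [disjoint_left]
    rintro ⟨x, y⟩ h1 h2
    simp only [mem_filter, mem_univ, true_and] at h1 h2
    exact disjoint_nbhd_parts hY.symm hS x y h1 h2

lemma TightCayley.prod_bound (hX : TightCayley m r) (hY : TightCayley m s) {S : Finset (X × Y)}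
    (hS : Indep (prodRel r s) S) : m * #S ≤ Fintype.card (X × Y) := by
  rw [card_eq_isolated_add_linked s S, mul_add, mul_sum, mul_sum]
  refine le_trans (add_le_add ?_ ?_) (sum_nbhd_parts_le hY hS)
  · exact sum_le_sum fun x _ => hY.le_card_nbhd (indep_isolatedPart x)
  · exact sum_le_sum fun y _ => hX.le_card_nbhd (indep_linkedPart hS y)

lemma Indep.prod_univ {T : Finset X} (hT : Indep r T) :
    Indep (prodRel r s) (T ×ˢ (univ : Finset Y)) := fun _ hp _ hq h =>
  hT _ (mem_product.1 hp).1 _ (mem_product.1 hq).1 h.1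

lemma Indep.univ_prod {T : Finset Y} (hT : Indep s T) :
    Indep (prodRel r s) ((univ : Finset X) ×ˢ T) := fun _ hp _ hq h =>
  hT _ (mem_product.1 hp).2 _ (mem_product.1 hq).2 h.2

lemma card_prod_univ_tight {T : Finset X} (hT : m * #T = Fintype.card X) :
    m * #(T ×ˢ (univ : Finset Y)) = Fintype.card (X × Y) := by
  rw [card_product, Fintype.card_prod, ← hT, card_univ, mul_assoc]

lemma card_univ_prod_tight {T : Finset Y} (hT : m * #T = Fintype.card Y) :
    m * #((univ : Finset X) ×ˢ T) = Fintype.card (X × Y) := by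
  rw [card_product, Fintype.card_prod, ← hT, card_univ]
  ring

lemma TightCayley.prod (hX : TightCayley m r) (hY : TightCayley m s) :
    TightCayley m (prodRel r s) where
  symm _ _ h := ⟨hX.symm _ _ h.1, hY.symm _ _ h.2⟩
  inv _ _ _ h := ⟨hX.inv _ _ _ h.1, hY.inv _ _ _ h.2⟩
  bound _ hS := hX.prod_bound hY hS
  tight := by
    obtain ⟨T, hT, hTc⟩ := hX.tight
    exact ⟨_, hT.prod_univ, card_prod_univ_tight hTc⟩

/-- A maximum independent set dominates the graph, so a point of `U` outside `T` would have a
neighbour in `T`. -/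
lemma eq_of_tight_of_no_edge (hY : TightCayley m s) {T U : Finset Y}
    (hT : Indep s T) (hTc : m * #T = Fintype.card Y) (hUc : m * #U = Fintype.card Y)
    (h : ∀ y ∈ T, ∀ y' ∈ U, ¬ s y y') : U = T := by
  refine eq_of_subset_of_card_le (fun y hy => ?_)
    (Nat.le_of_mul_le_mul_left (hTc.trans hUc.symm).le hY.m_pos)
  have : y ∈ nbhd s T := by rw [hY.nbhd_eq_univ hT hTc]; exact mem_univ _
  rcases mem_nbhd.1 this with h' | ⟨a, ha, hay⟩
  · exact h'
  · exact absurd hay (h a ha y hy)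

lemma constant_of_locally_constant (hX : TightCayley m r) (pX : Primitive m r)
    {β : Type*} (F : X → β) (hF : ∀ x x', r x x' → F x' = F x) (x : X) : F x = F 1 := by
  have h := hX.eq_univ_of_closed pX (univ.filter fun x => F x = F 1) ?_ ⟨1, by simp⟩
  · have : x ∈ univ.filter fun x => F x = F 1 := by rw [h]; exact mem_univ _
    simpa using this
  · intro a b hab ha
    simp only [mem_filter, mem_univ, true_and] at ha ⊢
    rw [hF a b hab, ha]

/-- Maximum independent sets in a direct product of primitive graphs come from a factor. -/
lemma tight_prod_cases (hX : TightCayley m r) (hY : TightCayley m s)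
    (pX : Primitive m r) (pY : Primitive m s) {S : Finset (X × Y)}
    (hS : Indep (prodRel r s) S) (hSc : m * #S = Fintype.card (X × Y)) :
    (∃ T, Indep r T ∧ m * #T = Fintype.card X ∧ S = T ×ˢ univ) ∨
    (∃ T, Indep s T ∧ m * #T = Fintype.card Y ∧ S = univ ×ˢ T) := by
  have hA : ∀ x ∈ (univ : Finset X), m * #(isolatedPart s S x) ≤ #(nbhd s (isolatedPart s S x)) :=
    fun x _ => hY.le_card_nbhd (indep_isolatedPart x)
  have hB : ∀ y ∈ (univ : Finset Y), m * #(linkedPart s S y) ≤ #(nbhd r (linkedPart s S y)) :=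
    fun y _ => hX.le_card_nbhd (indep_linkedPart hS y)
  have sA := sum_le_sum hA
  have sB := sum_le_sum hB
  have sN := sum_nbhd_parts_le (r := r) hY hS
  have hc := hSc
  rw [card_eq_isolated_add_linked s S, mul_add, mul_sum, mul_sum] at hc
  -- `S` attains the bound obtained by summing over fibres, so each fibre attains its own bound.
  have eA := (sum_eq_sum_iff_of_le hA).1 (by omega)
  have eB := (sum_eq_sum_iff_of_le hB).1 (by omega)
  -- The disjoint closed neighbourhoods of the two kinds of parts have total size `|X × Y|`, so they
  -- cover the product.
  have hcov : ∀ x y, y ∈ nbhd s (isolatedPart s S x) ∨ x ∈ nbhd r (linkedPart s S y) := by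
    have hu : (univ.filter fun p : X × Y => p.2 ∈ nbhd s (isolatedPart s S p.1)) ∪
        (univ.filter fun p : X × Y => p.1 ∈ nbhd r (linkedPart s S p.2)) = univ := by
      rw [← card_eq_iff_eq_univ, card_union_of_disjoint,
        card_filter_snd (fun x => nbhd s (isolatedPart s S x)),
        card_filter_fst (fun y => nbhd r (linkedPart s S y))]
      · omega
      · rw [disjoint_left]
        rintro ⟨x, y⟩ h1 h2
        simp only [mem_filter, mem_univ, true_and] at h1 h2
        exact disjoint_nbhd_parts hY.symm hS x y h1 h2
    intro x y
    have : (x, y) ∈ (univ : Finset (X × Y)) := mem_univ _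
    rw [← hu] at this
    simpa only [mem_union, mem_filter, mem_univ, true_and] using this
  by_cases hex : ∃ x, (isolatedPart s S x).Nonempty
  · right
    obtain ⟨x₀, hx₀⟩ := hex
    have hN : nbhd s (isolatedPart s S x₀) = univ :=
      hY.nbhd_eq_univ (indep_isolatedPart x₀)
        (pY _ (indep_isolatedPart x₀) hx₀ (eA x₀ (mem_univ _)))
    -- By primitivity a nonempty part has a full neighbourhood; an isolated and a linked part cannot
    -- both be nonempty, as their neighbourhoods would meet at `(x₀, y)`.
    have hB0 : ∀ y, linkedPart s S y = ∅ := by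
      intro y
      by_contra hne
      have hN' : nbhd r (linkedPart s S y) = univ :=
        hX.nbhd_eq_univ (indep_linkedPart hS y)
          (pX _ (indep_linkedPart hS y) (nonempty_iff_ne_empty.2 hne) (eB y (mem_univ _)))
      exact disjoint_nbhd_parts hY.symm hS x₀ y (by rw [hN]; exact mem_univ _)
        (by rw [hN']; exact mem_univ _)
    have hmem : ∀ x y, (x, y) ∈ S ↔ y ∈ isolatedPart s S x := by
      intro x y
      rw [mem_isolatedPart]
      refine ⟨fun h => ⟨h, fun y' hy' hm => ?_⟩, fun h => h.1⟩
      have : x ∈ linkedPart s S y := mem_linkedPart.2 ⟨h, y', hy', hm⟩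
      rw [hB0] at this
      exact notMem_empty _ this
    have hAc : ∀ x, m * #(isolatedPart s S x) = Fintype.card Y := by
      intro x
      rw [eA x (mem_univ _), card_eq_iff_eq_univ, eq_univ_iff_forall]
      intro y
      rcases hcov x y with h | h
      · exact h
      · simp [hB0] at h
    have hconst := constant_of_locally_constant hX pX (fun x => isolatedPart s S x) (by
      intro x x' hxx
      refine eq_of_tight_of_no_edge hY (indep_isolatedPart x) (hAc x) (hAc x') ?_
      intro y hy y' hy' hyy
      exact hS _ ((hmem _ _).2 hy) _ ((hmem _ _).2 hy') ⟨hxx, hyy⟩)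
    refine ⟨_, indep_isolatedPart (1 : X), hAc 1, ?_⟩
    ext ⟨x, y⟩
    simp only [mem_product, mem_univ, true_and]
    rw [hmem, hconst x]
  · left
    push Not at hex
    have hmem : ∀ x y, (x, y) ∈ S ↔ x ∈ linkedPart s S y := by
      intro x y
      rw [mem_linkedPart]
      refine ⟨fun h => ⟨h, ?_⟩, fun h => h.1⟩
      by_contra hne
      push Not at hne
      have : y ∈ isolatedPart s S x := mem_isolatedPart.2 ⟨h, hne⟩
      rw [hex] at this
      exact notMem_empty _ this
    have hBc : ∀ y, m * #(linkedPart s S y) = Fintype.card X := by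
      intro y
      rw [eB y (mem_univ _), card_eq_iff_eq_univ, eq_univ_iff_forall]
      intro x
      rcases hcov x y with h | h
      · simp [hex] at h
      · exact h
    have hconst := constant_of_locally_constant hY pY (fun y => linkedPart s S y) (by
      intro y y' hyy
      refine eq_of_tight_of_no_edge hX (indep_linkedPart hS y) (hBc y) (hBc y') ?_
      intro x hx x' hx' hxx
      exact hS _ ((hmem _ _).2 hx) _ ((hmem _ _).2 hx') ⟨hxx, hyy⟩)
    refine ⟨_, indep_linkedPart hS (1 : Y), hBc 1, ?_⟩
    ext ⟨x, y⟩
    simp only [mem_product, mem_univ, and_true]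
    rw [hmem, hconst y]

end Product

/-! ### Primitivity of a product, when `S` lies over a maximum-size set in one factor. -/

section ProductPrimitive

variable {X Y : Type*} [Fintype X] [Fintype Y] [Group X] [Group Y] {m : ℕ}
  {r : X → X → Prop} {s : Y → Y → Prop}

lemma exists_notMem_of_tight (hm : 2 ≤ m) {T : Finset X} (hTc : m * #T = Fintype.card X) :
    ∃ x, x ∉ T := by
  by_contra! h
  have h1 : #T = Fintype.card X := (card_eq_iff_eq_univ T).2 (eq_univ_iff_forall.2 h)
  have h2 : 0 < Fintype.card X := Fintype.card_pos
  nlinarith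

lemma nonempty_of_tight {T : Finset X} (hTc : m * #T = Fintype.card X) : T.Nonempty := by
  have h2 : 0 < Fintype.card X := Fintype.card_pos
  exact card_pos.1 (Nat.pos_of_mul_pos_left (hTc ▸ h2))

lemma TightCayley.exists_tight_notMem (hX : TightCayley m r) (hm : 2 ≤ m) (x : X) :
    ∃ T, Indep r T ∧ m * #T = Fintype.card X ∧ x ∉ T := by
  obtain ⟨T, hT, hTc⟩ := hX.tight
  obtain ⟨y, hy⟩ := exists_notMem_of_tight hm hTc
  refine ⟨translate T (y⁻¹ * x), hX.indep_translate hT _, by rw [card_translate, hTc], ?_⟩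
  simpa using hy

/-- Exchanging `S` into `univ ×ˢ T₁` gives a maximum independent set, known by `tight_prod_cases`.
Outside `univ ×ˢ T₁` only points of `S` remain, so `S` can be read off there; varying `T₁` recovers
all of it. -/
lemma eq_prod_univ_of_subset (hX : TightCayley m r) (hY : TightCayley m s)
    (pX : Primitive m r) (pY : Primitive m s) (hm : 3 ≤ m) {S : Finset (X × Y)}
    (hS : Indep (prodRel r s) S) (hne : S.Nonempty) (hSc : m * #S = #(nbhd (prodRel r s) S))
    {T₀ : Finset X} (hT₀c : m * #T₀ = Fintype.card X)
    (hsub : ∀ p ∈ S, p.1 ∈ T₀) : S = T₀ ×ˢ univ := by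
  have key : ∀ T₁ : Finset Y, Indep s T₁ → m * #T₁ = Fintype.card Y → (∃ p ∈ S, p.2 ∉ T₁) →
      ∀ x ∈ T₀, ∀ y, y ∉ T₁ → (x, y) ∈ S := by
    rintro T₁ hT₁ hT₁c ⟨p, hp, hpT⟩ x hx y hy
    have hI := hS.union_sdiff (hX.prod hY).symm (hT₁.univ_prod (r := r))
    have hIc := (hX.prod hY).exchange hS hSc hT₁.univ_prod (card_univ_prod_tight hT₁c)
    rcases tight_prod_cases hX hY pX pY hI hIc with ⟨T₂, -, hT₂c, h⟩ | ⟨T₂, -, hT₂c, h⟩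
    · have hmem : ∀ a ∈ T₂, ∀ b, b ∉ T₁ → (a, b) ∈ S := by
        intro a ha b hb
        have : (a, b) ∈ T₂ ×ˢ (univ : Finset Y) := by simp [ha]
        rw [← h, mem_union, mem_sdiff, mem_product] at this
        rcases this with h' | h'
        · exact h'
        · exact absurd h'.1.2 hb
      have hT : T₂ = T₀ := by
        refine eq_of_subset_of_card_le (fun a ha => hsub _ (hmem a ha y hy)) ?_
        exact Nat.le_of_mul_le_mul_left (hT₀c.trans hT₂c.symm).le hX.m_pos
      exact hmem x (hT ▸ hx) y hy
    -- Here the whole row through `p` would be present, but a point of it over `x₀ ∉ T₀` lies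
    -- neither in `S` nor in `univ ×ˢ T₁`.
    · exfalso
      obtain ⟨x₀, hx₀⟩ := exists_notMem_of_tight (by omega) hT₀c
      have hp2 : p ∈ (univ : Finset X) ×ˢ T₂ := by
        rw [← h]; exact mem_union_left _ hp
      have : (x₀, p.2) ∈ (univ : Finset X) ×ˢ T₂ :=
        mem_product.2 ⟨mem_univ _, (mem_product.1 hp2).2⟩
      rw [← h, mem_union, mem_sdiff, mem_product] at this
      rcases this with h' | h'
      · exact hx₀ (hsub _ h')
      · exact hpT h'.1.2
  obtain ⟨x₀, hx₀⟩ := nonempty_of_tight hT₀c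
  have hall : ∀ T₁ : Finset Y, m * #T₁ = Fintype.card Y → ∃ p ∈ S, p.2 ∉ T₁ := by
    obtain ⟨p, hp⟩ := hne
    obtain ⟨T, hT, hTc, hpT⟩ := hY.exists_tight_notMem (by omega) p.2
    have hk := key T hT hTc ⟨p, hp, hpT⟩
    intro T₁ hT₁c
    -- This needs `m ≥ 3`: the complement of `T` has `(m - 1) |T₁| > |T₁|` elements. For `m = 2` the
    -- conclusion about products fails, as for `K₂ × K₂`, which is disconnected.
    have : ∃ y ∈ Tᶜ, y ∉ T₁ := by
      by_contra! hcon
      have h1 : #Tᶜ ≤ #T₁ := card_le_card hcon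
      have h2 := card_add_card_compl T
      have h3 : #T = #T₁ := Nat.eq_of_mul_eq_mul_left hX.m_pos (hTc.trans hT₁c.symm)
      have h4 := (nonempty_of_tight hTc).card_pos
      nlinarith
    obtain ⟨y, hy, hyT⟩ := this
    exact ⟨(x₀, y), hk x₀ hx₀ y (mem_compl.1 hy), hyT⟩
  ext ⟨x, y⟩
  simp only [mem_product, mem_univ, and_true]
  refine ⟨hsub _, fun hx => ?_⟩
  obtain ⟨T, hT, hTc, hyT⟩ := hY.exists_tight_notMem (by omega) y
  exact key T hT hTc (hall T hTc) x hx y hyT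

end ProductPrimitive

/-! ### Invariance under isomorphism. -/

section Transfer

variable {K L : Type*} [Fintype K] [Fintype L] {m : ℕ}
  {r : K → K → Prop} {s : L → L → Prop} (e : K ≃ L)

lemma indep_map_equiv (he : ∀ x y, s (e x) (e y) ↔ r x y) {S : Finset K} :
    Indep s (S.map e.toEmbedding) ↔ Indep r S := by
  simp only [Indep, mem_map_equiv]
  refine ⟨fun h x hx y hy hxy => h (e x) (by simpa) (e y) (by simpa) ((he _ _).2 hxy),
    fun h x hx y hy hxy => h _ hx _ hy ?_⟩
  rw [← he]
  simpa

lemma nbhd_map_equiv (he : ∀ x y, s (e x) (e y) ↔ r x y) (S : Finset K) :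
    nbhd s (S.map e.toEmbedding) = (nbhd r S).map e.toEmbedding := by
  ext w
  obtain ⟨x, rfl⟩ := e.surjective w
  rw [mem_nbhd, ← e.coe_toEmbedding, mem_map', mem_map', mem_nbhd]
  refine or_congr_right ⟨?_, ?_⟩
  · rintro ⟨a, ha, h⟩
    obtain ⟨b, hb, rfl⟩ := mem_map.1 ha
    exact ⟨b, hb, (he _ _).1 h⟩
  · rintro ⟨a, ha, h⟩
    exact ⟨e a, (mem_map' e.toEmbedding).2 ha, (he _ _).2 h⟩

lemma Primitive.of_equiv (he : ∀ x y, s (e x) (e y) ↔ r x y) (hp : Primitive m s) :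
    Primitive m r := by
  intro S hS hne hSc
  have := hp (S.map e.toEmbedding) ((indep_map_equiv e he).2 hS) (hne.map)
    (by rw [nbhd_map_equiv e he, card_map, card_map, hSc])
  rwa [card_map, ← Fintype.card_congr e] at this

lemma TightCayley.of_equiv [Group K] [Group L] (e : K ≃* L) (he : ∀ x y, s (e x) (e y) ↔ r x y)
    (h : TightCayley m s) : TightCayley m r where
  symm x y hxy := (he _ _).1 (h.symm _ _ ((he _ _).2 hxy))
  inv x y g hxy := by
    rw [← he, map_mul, map_mul]
    exact h.inv _ _ _ ((he _ _).2 hxy)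
  bound S hS := by
    have := h.bound _ ((indep_map_equiv e.toEquiv he).2 hS)
    rwa [card_map, ← Fintype.card_congr e.toEquiv] at this
  tight := by
    obtain ⟨T, hT, hTc⟩ := h.tight
    have h' : ∀ x y, r (e.symm x) (e.symm y) ↔ s x y := fun x y => by rw [← he]; simp
    refine ⟨_, (indep_map_equiv e.symm.toEquiv h').2 hT, ?_⟩
    rw [card_map, hTc, Fintype.card_congr e.toEquiv]

end Transfer

/-! ### Primitivity of a product in general. -/

section ProductPrimitive

variable {X Y : Type*} [Fintype X] [Fintype Y] [Group X] [Group Y] {m : ℕ}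
  {r : X → X → Prop} {s : Y → Y → Prop}

/-- By exchange, `S` sits inside a maximum independent set, which is a cylinder over one factor;
`eq_prod_univ_of_subset` then applies, after swapping the factors if necessary. -/
lemma Primitive.prod (hX : TightCayley m r) (hY : TightCayley m s)
    (pX : Primitive m r) (pY : Primitive m s) (hm : 3 ≤ m) : Primitive m (prodRel r s) := by
  intro S hS hne hSc
  obtain ⟨T, hT, hTc⟩ := (hX.prod hY).tight
  have hI := hS.union_sdiff (hX.prod hY).symm hT
  have hIc := (hX.prod hY).exchange hS hSc hT hTc
  rcases tight_prod_cases hX hY pX pY hI hIc with ⟨T₀, -, hT₀c, h⟩ | ⟨T₀, -, hT₀c, h⟩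
  · rw [eq_prod_univ_of_subset hX hY pX pY hm hS hne hSc hT₀c, card_prod_univ_tight hT₀c]
    intro p hp
    have : p ∈ T₀ ×ˢ (univ : Finset Y) := by rw [← h]; exact mem_union_left _ hp
    exact (mem_product.1 this).1
  · have he : ∀ p q : X × Y, prodRel s r (Equiv.prodComm X Y p) (Equiv.prodComm X Y q) ↔
        prodRel r s p q := fun p q => and_comm
    have := eq_prod_univ_of_subset hY hX pY pX hm ((indep_map_equiv _ he).2 hS) hne.map
      (by rw [nbhd_map_equiv _ he, card_map, card_map, hSc]) hT₀c (by
        intro p hp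
        obtain ⟨q, hq, rfl⟩ := mem_map.1 hp
        have : q ∈ (univ : Finset X) ×ˢ T₀ := by rw [← h]; exact mem_union_left _ hq
        exact (mem_product.1 this).2)
    rw [← card_map (Equiv.prodComm X Y).toEmbedding, this, card_prod_univ_tight hT₀c,
      Fintype.card_congr (Equiv.prodComm X Y)]

end ProductPrimitive

/-! ### Direct powers, by induction. -/

section Power

variable {K : Type*} [Fintype K] [Group K] {m : ℕ} {r : K → K → Prop}

/-- The direct power of a relation. -/
def powRel (r : K → K → Prop) (n : ℕ) (f g : Fin n → K) : Prop := ∀ i, r (f i) (g i)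

/-- Splitting off the first coordinate. -/
def consMulEquiv (K : Type*) [Group K] (n : ℕ) : (Fin (n + 1) → K) ≃* K × (Fin n → K) where
  toEquiv := (Fin.consEquiv fun _ => K).symm
  map_mul' _ _ := rfl

lemma prodRel_consMulEquiv (n : ℕ) (f g : Fin (n + 1) → K) :
    prodRel r (powRel r n) (consMulEquiv K n f) (consMulEquiv K n g) ↔ powRel r (n + 1) f g :=
  (Fin.forall_fin_succ (P := fun i => r (f i) (g i))).symm

lemma powRel_one (f g : Fin 1 → K) :
    r (MulEquiv.funUnique (Fin 1) K f) (MulEquiv.funUnique (Fin 1) K g) ↔ powRel r 1 f g := by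
  simp [powRel]

/-- Powers start at exponent one: the empty power relation always holds, so no nonempty set is
independent for it. -/
lemma TightCayley.pow (h : TightCayley m r) (n : ℕ) : TightCayley m (powRel r (n + 1)) := by
  induction n with
  | zero => exact h.of_equiv (MulEquiv.funUnique (Fin 1) K) powRel_one
  | succ n ih => exact (h.prod ih).of_equiv (consMulEquiv K (n + 1)) (prodRel_consMulEquiv _)

lemma Primitive.pow (h : TightCayley m r) (hp : Primitive m r) (hm : 3 ≤ m) (n : ℕ) :
    Primitive m (powRel r (n + 1)) := by
  induction n with
  | zero => exact hp.of_equiv (MulEquiv.funUnique (Fin 1) K).toEquiv powRel_one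
  | succ n ih =>
    exact (Primitive.prod h (h.pow n) hp ih hm).of_equiv (consMulEquiv K (n + 1)).toEquiv
      (prodRel_consMulEquiv _)

/-- Maximum independent sets in a power of a primitive graph are determined by one coordinate. -/
lemma tight_pow_cases (h : TightCayley m r) (hp : Primitive m r) (hm : 3 ≤ m) (n : ℕ)
    {S : Finset (Fin (n + 1) → K)} (hS : Indep (powRel r (n + 1)) S)
    (hSc : m * #S = Fintype.card (Fin (n + 1) → K)) :
    ∃ i T, Indep r T ∧ m * #T = Fintype.card K ∧ ∀ f, f ∈ S ↔ f i ∈ T := by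
  induction n with
  | zero =>
    let e := (MulEquiv.funUnique (Fin 1) K).toEquiv
    refine ⟨0, S.map e.toEmbedding, (indep_map_equiv e powRel_one).2 hS, ?_, fun f => ?_⟩
    · rw [card_map, hSc, Fintype.card_congr e]
    · exact (mem_map' e.toEmbedding (a := f)).symm
  | succ n ih =>
    let e := (consMulEquiv K (n + 1)).toEquiv
    have hmem : ∀ f, f ∈ S ↔ e f ∈ S.map e.toEmbedding :=
      fun f => (mem_map' e.toEmbedding (a := f)).symm
    have h1 := (indep_map_equiv e (prodRel_consMulEquiv (r := r) (n + 1))).2 hS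
    have h2 : m * #(S.map e.toEmbedding) = Fintype.card (K × (Fin (n + 1) → K)) := by
      rw [card_map, hSc, Fintype.card_congr e]
    rcases tight_prod_cases h (h.pow n) hp (Primitive.pow h hp hm n) h1 h2 with
      ⟨T, hT, hTc, hST⟩ | ⟨T, hT, hTc, hST⟩
    · refine ⟨0, T, hT, hTc, fun f => ?_⟩
      rw [hmem, hST, mem_product]
      exact and_iff_left (mem_univ _)
    · obtain ⟨i, U, hU, hUc, hTU⟩ := ih hT hTc
      refine ⟨i.succ, U, hU, hUc, fun f => ?_⟩
      rw [hmem, hST, mem_product, hTU]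
      exact and_iff_right (mem_univ _)

end Power

/-! ### Translation between permutation groups and the graph setting. -/

section Derangements

variable {V : Type*} {G : Subgroup (Perm V)}

/-- Two elements of a permutation group are related if they agree nowhere. -/
def permRel (G : Subgroup (Perm V)) (x y : G) : Prop := ∀ v, (x : Perm V) v ≠ (y : Perm V) v

lemma indep_permRel {S : Finset G} : Indep (permRel G) S ↔ IsIntersecting G S := by
  simp [Indep, permRel, IsIntersecting]

lemma adj_iff_permRel [Nonempty V] {x y : G} :
    (derangementGraph G).Adj x y ↔ permRel G x y := by
  have h : ((x * y⁻¹ : G) : Perm V) ∈ derangements V ↔ permRel G x y := by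
    constructor
    · intro h v hv
      apply h ((y : Perm V) v)
      simp [hv]
    · intro h v hv
      apply h ((y : Perm V)⁻¹ v)
      simpa using hv
  refine ⟨fun ha => h.1 ha.2, fun hr => ⟨?_, h.2 hr⟩⟩
  rintro rfl
  obtain ⟨v⟩ := ‹Nonempty V›
  exact hr v rfl

lemma isStabilizerCoset_iff {I : Finset G} :
    IsStabilizerCoset G I ↔ ∃ (g : G) (v : V), ∀ x, x ∈ I ↔ (x : Perm V) v = (g : Perm V) v := by
  unfold IsStabilizerCoset
  refine exists_congr fun g => exists_congr fun v => ?_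
  rw [Set.ext_iff]
  refine forall_congr' fun x => iff_congr mem_coe ?_
  rw [Set.mem_ofPred_eq]
  constructor
  · rintro ⟨s, hs, rfl⟩
    have : (s : Perm V) v = v := hs
    simp [this]
  · intro h
    refine ⟨g⁻¹ * x, ?_, by group⟩
    change ((g⁻¹ * x : G) : Perm V) v = v
    simp [h]

variable [Fintype G]

lemma card_pointwise [Fintype V] (hG : MulAction.IsPretransitive G V) (v w : V) :
    Fintype.card V * #(univ.filter fun x : G => (x : Perm V) v = w) = Fintype.card G := by
  have h1 := card_eq_sum_card_fiberwise (s := (univ : Finset G)) (t := (univ : Finset V))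
    (f := fun x : G => (x : Perm V) v) (fun _ _ => mem_coe.2 (mem_univ _))
  rw [card_univ] at h1
  rw [h1, ← card_univ, ← smul_eq_mul, ← sum_const]
  refine sum_congr rfl fun u _ => ?_
  obtain ⟨g, hg⟩ := hG.exists_smul_eq w u
  have hg' : (g : Perm V) w = u := hg
  refine card_bij' (fun x _ => g * x) (fun x _ => g⁻¹ * x) ?_ ?_ ?_ ?_
  · intro x hx
    simp only [mem_filter, mem_univ, true_and] at hx ⊢
    simp [hx, hg']
  · intro x hx
    simp only [mem_filter, mem_univ, true_and] at hx ⊢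
    simp [hx, ← hg']
  · simp
  · simp

lemma indep_pointwise (v w : V) :
    Indep (permRel G) (univ.filter fun x : G => (x : Perm V) v = w) := by
  intro x hx y hy h
  simp only [mem_filter, mem_univ, true_and] at hx hy
  exact h v (hx.trans hy.symm)

lemma indep_singleton_permRel [Nonempty V] (x : G) : Indep (permRel G) {x} := by
  simp [Indep, permRel]

lemma tightCayley_of_bound [Fintype V] [Nonempty V] (hG : MulAction.IsPretransitive G V)
    (hb : ∀ S, Indep (permRel G) S → Fintype.card V * #S ≤ Fintype.card G) :
    TightCayley (Fintype.card V) (permRel G) where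
  symm _ _ h v := (h v).symm
  inv _ _ g h v := by simpa using h ((g : Perm V) v)
  bound := hb
  tight := by
    obtain ⟨v⟩ := ‹Nonempty V›
    exact ⟨_, indep_pointwise v v, card_pointwise hG v v⟩

lemma exists_max_indep {K : Type*} [Fintype K] (r : K → K → Prop) :
    ∃ T : Finset K, Indep r T ∧ ∀ S, Indep r S → #S ≤ #T := by
  obtain ⟨T, hT, hmax⟩ := exists_max_image (univ.filter fun S : Finset K => Indep r S) card
    ⟨∅, mem_filter.2 ⟨mem_univ _, by simp [Indep]⟩⟩
  exact ⟨T, (mem_filter.1 hT).2, fun S hS => hmax S (mem_filter.2 ⟨mem_univ _, hS⟩)⟩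

/-- A maximum intersecting set is a stabilizer coset, whose size is `|G| / |V|` by transitivity. -/
lemma StrictEKR.tightCayley [Fintype V] [Nonempty V] (hG : MulAction.IsPretransitive G V)
    (h : StrictEKR G) : TightCayley (Fintype.card V) (permRel G) := by
  refine tightCayley_of_bound hG fun S hS => ?_
  obtain ⟨T, hT, hmax⟩ := exists_max_indep (permRel G)
  obtain ⟨g, v, hgv⟩ := isStabilizerCoset_iff.1
    (h T ⟨indep_permRel.1 hT, fun J hJ => hmax J (indep_permRel.2 hJ)⟩)
  have hTe : T = univ.filter fun x : G => (x : Perm V) v = (g : Perm V) v := by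
    ext x; simp [hgv]
  rw [← card_pointwise hG v ((g : Perm V) v), ← hTe]
  exact Nat.mul_le_mul_left _ (hmax S hS)

lemma isIndepSet_iff_indep [Nonempty V] {S : Finset G} :
    (derangementGraph G).IsIndepSet (S : Set G) ↔ Indep (permRel G) S := by
  constructor
  · intro h x hx y hy hxy
    have ha := adj_iff_permRel.2 hxy
    exact h hx hy ha.1 ha
  · intro h x hx y hy _ hxy
    exact h x hx y hy (adj_iff_permRel.1 hxy)

lemma ncard_closedNeighborhood [Nonempty V] (S : Finset G) :
    (closedNeighborhood (derangementGraph G) (S : Set G)).ncard = #(nbhd (permRel G) S) := by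
  rw [← Set.ncard_coe_finset]
  congr 1
  ext w
  simp [closedNeighborhood, adj_iff_permRel]

lemma mul_indepNum [Nonempty V] {m : ℕ} (h : TightCayley m (permRel G)) :
    m * (derangementGraph G).indepNum = Fintype.card G := by
  obtain ⟨S, hS⟩ := (derangementGraph G).exists_isNIndepSet_indepNum
  obtain ⟨T, hT, hTc⟩ := h.tight
  have h1 := h.bound S (isIndepSet_iff_indep.1 hS.isIndepSet)
  rw [hS.card_eq] at h1
  have h2 := (isIndepSet_iff_indep.2 hT).card_le_indepNum
  have h3 := Nat.mul_le_mul_left m h2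
  omega

lemma isPrimitive_iff [Nonempty V] {m : ℕ} (h : TightCayley m (permRel G)) :
    ISPrimitive (derangementGraph G) ↔ Primitive m (permRel G) := by
  have hα := mul_indepNum h
  have hm := h.m_pos
  have hcard : 0 < Fintype.card G := Fintype.card_pos
  have hr : ((derangementGraph G).indepNum : ℚ) / (Nat.card G : ℚ) = 1 / m := by
    rw [Nat.card_eq_fintype_card, div_eq_div_iff (by positivity) (by positivity)]
    rw [← hα]; push_cast; ring
  have hA : ∀ A : Finset G, A.Nonempty → ((A.card : ℚ) /
      ((closedNeighborhood (derangementGraph G) (A : Set G)).ncard : ℚ) =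
      ((derangementGraph G).indepNum : ℚ) / (Nat.card G : ℚ) ↔
        m * #A = #(nbhd (permRel G) A)) := by
    intro A hne
    have hpos : 0 < #(nbhd (permRel G) A) := (hne.mono subset_nbhd).card_pos
    rw [hr, ncard_closedNeighborhood, div_eq_div_iff (by positivity) (by positivity), mul_comm,
      one_mul]
    exact_mod_cast Iff.rfl
  constructor
  · intro hp A hAi hne hAc
    by_contra hlt
    refine hp ⟨A, hne, isIndepSet_iff_indep.2 hAi, ?_, (hA A hne).2 hAc⟩
    have := h.bound A hAi
    refine Nat.lt_of_mul_lt_mul_left (a := m) ?_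
    omega
  · rintro hp ⟨A, hne, hAi, hlt, hAc⟩
    have := hp A (isIndepSet_iff_indep.1 hAi) hne ((hA A hne).1 hAc)
    rw [← hα] at this
    exact hlt.ne (Nat.eq_of_mul_eq_mul_left hm this)

end Derangements

/-! ### Reduction of the wreath product to a power of the derangement graph. -/

section Wreath

variable {V : Type*} {G : Subgroup (Perm V)} {N : Type*} {H : Subgroup (Perm N)}

/-- The element `(a, i) ↦ (g i a, h i)` of the wreath product. -/
def wreathElem (g : N → G) (h : H) : wreath G H :=
  ⟨wreathPerm (fun i => g i) h, _, _, fun i => (g i).2, h.2, rfl⟩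

lemma wreathElem_apply (g : N → G) (h : H) (v : V) (i : N) :
    (wreathElem g h : Perm (V × N)) (v, i) = ((g i : Perm V) v, (h : Perm N) i) := rfl

lemma exists_eq_wreathElem (x : wreath G H) : ∃ g h, x = wreathElem g h := by
  obtain ⟨x, g, h, hg, hh, rfl⟩ := x
  exact ⟨fun i => ⟨g i, hg i⟩, ⟨h, hh⟩, rfl⟩

lemma wreathElem_injective [Nonempty V] {g g' : N → G} {h h' : H}
    (he : wreathElem g h = wreathElem g' h') : g = g' ∧ h = h' := by
  have key : ∀ v i, ((g i : Perm V) v, (h : Perm N) i) = ((g' i : Perm V) v, (h' : Perm N) i) :=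
    fun v i => by rw [← wreathElem_apply, he, wreathElem_apply]
  obtain ⟨v⟩ := ‹Nonempty V›
  refine ⟨?_, ?_⟩
  · ext i w
    exact congrArg Prod.fst (key w i)
  · ext i
    exact congrArg Prod.snd (key v i)

lemma IsRegularPermGroup.eq_of_apply_eq (hH : IsRegularPermGroup H) {h h' : H} {i : N}
    (hi : (h : Perm N) i = (h' : Perm N) i) : h = h' := by
  have : h'⁻¹ * h ∈ MulAction.stabilizer H i := by
    change ((h'⁻¹ * h : H) : Perm N) i = i
    simp [hi]
  rw [hH.2 i, Subgroup.mem_bot] at this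
  exact (inv_mul_eq_one.1 this).symm

/-- Maximum independent sets of the power of the derangement graph are point cosets in a
coordinate. -/
def PowStrictEKR (G : Subgroup (Perm V)) (n : ℕ) : Prop :=
  ∀ J : Finset (Fin n → G), Indep (powRel (permRel G) n) J →
    (∀ J' : Finset (Fin n → G), Indep (powRel (permRel G) n) J' → #J' ≤ #J) →
    ∃ i v w, ∀ f, f ∈ J ↔ (f i : Perm V) v = w

variable {n : ℕ} {H : Subgroup (Perm (Fin n))}

/-- The elements of the wreath product with top component `h` and base component in `J`. -/
noncomputable def baseImage (J : Finset (Fin n → G)) (h : H) : Finset (wreath G H) :=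
  J.image fun g => wreathElem g h

lemma mem_baseImage {J : Finset (Fin n → G)} {h : H} {x : wreath G H} :
    x ∈ baseImage J h ↔ ∃ g ∈ J, wreathElem g h = x := mem_image

lemma isIntersecting_baseImage {J : Finset (Fin n → G)} (h : H)
    (hJ : Indep (powRel (permRel G) n) J) :
    IsIntersecting (wreath G H) (baseImage J h) := by
  intro x hx y hy
  obtain ⟨g, hg, rfl⟩ := mem_baseImage.1 hx
  obtain ⟨g', hg', rfl⟩ := mem_baseImage.1 hy
  have := hJ g hg g' hg'
  simp only [powRel, permRel, ne_eq, not_forall, not_not] at this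
  obtain ⟨i, v, hv⟩ := this
  exact ⟨(v, i), by rw [wreathElem_apply, wreathElem_apply, hv]⟩

lemma card_baseImage [Nonempty V] (J : Finset (Fin n → G)) (h : H) :
    #(baseImage J h) = #J :=
  card_image_of_injective _ fun _ _ he => (wreathElem_injective he).1

/-- Every member agrees somewhere with a fixed `x₀`; regularity then gives it the same component in
`H` as `x₀`. -/
lemma exists_base_of_isIntersecting [Fintype V] [Nonempty V] (hH : IsRegularPermGroup H)
    {I : Finset (wreath G H)} (hI : IsIntersecting (wreath G H) I) :
    ∃ (h : H) (J : Finset (Fin n → G)), Indep (powRel (permRel G) n) J ∧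
      I = baseImage J h := by
  rcases I.eq_empty_or_nonempty with rfl | ⟨x₀, hx₀⟩
  · exact ⟨1, ∅, by simp [Indep], by simp [baseImage]⟩
  obtain ⟨g₀, h₀, rfl⟩ := exists_eq_wreathElem x₀
  refine ⟨h₀, univ.filter fun g => wreathElem g h₀ ∈ I, ?_, ?_⟩
  · intro g hg g' hg' hr
    obtain ⟨⟨v, i⟩, hv⟩ := hI _ (mem_filter.1 hg).2 _ (mem_filter.1 hg').2
    rw [wreathElem_apply, wreathElem_apply, Prod.mk.injEq] at hv
    exact hr i v hv.1
  · ext x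
    simp only [mem_baseImage, mem_filter, mem_univ, true_and]
    constructor
    · intro hx
      obtain ⟨g, h, rfl⟩ := exists_eq_wreathElem x
      obtain ⟨⟨v, i⟩, hv⟩ := hI _ hx _ hx₀
      rw [wreathElem_apply, wreathElem_apply, Prod.mk.injEq] at hv
      obtain rfl := hH.eq_of_apply_eq hv.2
      exact ⟨g, hx, rfl⟩
    · rintro ⟨g, hg, rfl⟩
      exact hg

lemma nonempty_of_max_indep [Nonempty V] (hn : 0 < n) {J : Finset (Fin n → G)}
    (hmax : ∀ J' : Finset (Fin n → G), Indep (powRel (permRel G) n) J' → #J' ≤ #J) :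
    J.Nonempty := by
  obtain ⟨v⟩ := ‹Nonempty V›
  have := hmax {1} (by
    intro x hx y hy h
    rw [mem_singleton.1 hx, mem_singleton.1 hy] at h
    exact h ⟨0, hn⟩ v rfl)
  rw [card_singleton] at this
  exact card_pos.1 this

lemma strictEKR_wreath_iff [Fintype V] [Nonempty V] (hn : 0 < n) (hH : IsRegularPermGroup H) :
    StrictEKR (wreath G H) ↔ PowStrictEKR G n := by
  constructor
  · intro hE J hJ hmax
    obtain ⟨g, hg⟩ := nonempty_of_max_indep hn hmax
    obtain ⟨x₀, ⟨v, i⟩, hx₀⟩ := isStabilizerCoset_iff.1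
      (hE (baseImage J (1 : H)) ⟨isIntersecting_baseImage 1 hJ, fun I hI => by
        obtain ⟨h, J', hJ', rfl⟩ := exists_base_of_isIntersecting hH hI
        rw [card_baseImage, card_baseImage]
        exact hmax J' hJ'⟩)
    obtain ⟨g₀, h₀, rfl⟩ := exists_eq_wreathElem x₀
    have hmem : ∀ f, f ∈ J ↔
        (f i : Perm V) v = (g₀ i : Perm V) v ∧ i = (h₀ : Perm (Fin n)) i := by
      intro f
      have h1 := hx₀ (wreathElem f 1)
      rw [wreathElem_apply, wreathElem_apply, Prod.mk.injEq] at h1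
      rw [← show ((1 : H) : Perm (Fin n)) i = i from rfl] at h1 ⊢
      refine Iff.trans ?_ h1
      rw [mem_baseImage]
      constructor
      · intro h
        exact ⟨f, h, rfl⟩
      · rintro ⟨f', hf', he⟩
        rwa [← (wreathElem_injective he).1]
    have hi := ((hmem g).1 hg).2
    exact ⟨i, v, _, fun f => (hmem f).trans (and_iff_left hi)⟩
  · intro hP I ⟨hI, hmax⟩
    obtain ⟨h, J, hJ, rfl⟩ := exists_base_of_isIntersecting hH hI
    have hJmax : ∀ J' : Finset (Fin n → G), Indep (powRel (permRel G) n) J' → #J' ≤ #J := by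
      intro J' hJ'
      have := hmax _ (isIntersecting_baseImage h hJ')
      rwa [card_baseImage, card_baseImage] at this
    obtain ⟨i, v, w, hw⟩ := hP J hJ hJmax
    obtain ⟨g, hg⟩ := nonempty_of_max_indep hn hJmax
    refine isStabilizerCoset_iff.2 ⟨wreathElem g h, (v, i), fun x => ?_⟩
    obtain ⟨g', h', rfl⟩ := exists_eq_wreathElem x
    rw [wreathElem_apply, wreathElem_apply, Prod.mk.injEq, mem_baseImage, (hw g).1 hg, ← hw]
    constructor
    · rintro ⟨f, hf, he⟩
      obtain ⟨rfl, rfl⟩ := wreathElem_injective he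
      exact ⟨hf, rfl⟩
    · rintro ⟨hg', hh⟩
      obtain rfl := hH.eq_of_apply_eq hh
      exact ⟨g', hg', rfl⟩

end Wreath

/-! ### Cylinders over one coordinate. -/

section Power

variable {K : Type*} [Fintype K] {n : ℕ}

/-- The functions whose `i`-th coordinate lies in `T`. -/
noncomputable def cylinder (i : Fin n) (T : Finset K) : Finset (Fin n → K) :=
  univ.filter fun f => f i ∈ T

@[simp] lemma mem_cylinder {i : Fin n} {T : Finset K} {f : Fin n → K} :
    f ∈ cylinder i T ↔ f i ∈ T := by simp [cylinder]

lemma card_cylinder (i : Fin n) (T : Finset K) :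
    #(cylinder i T) * Fintype.card K = #T * Fintype.card (Fin n → K) := by
  have h : cylinder i T = Fintype.piFinset (Function.update (fun _ => univ) i T) := by
    ext f
    rw [mem_cylinder, Fintype.mem_piFinset]
    constructor
    · intro h j
      by_cases hj : j = i
      · subst hj; simpa using h
      · simp [Function.update_of_ne hj]
    · intro h
      simpa using h i
  have h1 : ∀ j, #(Function.update (fun _ => (univ : Finset K)) i T j) =
      Function.update (fun _ => Fintype.card K) i #T j := by
    intro j
    by_cases hj : j = i
    · subst hj; simp
    · simp [Function.update_of_ne hj]
  rw [h, Fintype.card_piFinset, prod_congr rfl fun j _ => h1 j,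
    prod_update_of_mem (mem_univ i), Fintype.card_pi, ← mul_prod_erase univ _ (mem_univ i),
    sdiff_singleton_eq_erase]
  ring

lemma Indep.cylinder {r : K → K → Prop} {T : Finset K} (hT : Indep r T) (i : Fin n) :
    Indep (powRel r n) (cylinder i T) := fun _ hf _ hg h =>
  hT _ (mem_cylinder.1 hf) _ (mem_cylinder.1 hg) (h i)

lemma card_cylinder_tight [Nonempty K] {m : ℕ} {T : Finset K} (hT : m * #T = Fintype.card K)
    (i : Fin n) : m * #(cylinder i T) = Fintype.card (Fin n → K) := by
  refine Nat.eq_of_mul_eq_mul_right (Fintype.card_pos (α := K)) ?_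
  rw [mul_assoc, card_cylinder, ← mul_assoc, hT, mul_comm]

lemma nbhd_cylinder_subset (r : K → K → Prop) (A : Finset K) (i : Fin n) :
    nbhd (powRel r n) (cylinder i A) ⊆ cylinder i (nbhd r A) := by
  intro f hf
  simp only [mem_nbhd, mem_cylinder] at hf ⊢
  exact hf.imp_right fun ⟨a, ha, h⟩ => ⟨_, ha, h i⟩

end Power

/-! ### The two implications for powers of the derangement graph. -/

section Main

variable {V : Type*} [Fintype V] {G : Subgroup (Perm V)} {n : ℕ}

lemma powStrictEKR_of_primitive [Nonempty V] (hV : 3 ≤ Fintype.card V) (hE : StrictEKR G)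
    (h : TightCayley (Fintype.card V) (permRel G))
    (hp : Primitive (Fintype.card V) (permRel G)) (hn : 0 < n) : PowStrictEKR G n := by
  obtain ⟨k, rfl⟩ : ∃ k, n = k + 1 := ⟨n - 1, by omega⟩
  intro J hJ hmax
  have hJc : Fintype.card V * #J = Fintype.card (Fin (k + 1) → G) := by
    obtain ⟨T, hT, hTc⟩ := (h.pow k).tight
    refine le_antisymm ((h.pow k).bound J hJ) ?_
    rw [← hTc]
    exact Nat.mul_le_mul_left _ (hmax T hT)
  obtain ⟨i, T, hT, hTc, hmem⟩ := tight_pow_cases h hp hV k hJ hJc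
  obtain ⟨g, v, hgv⟩ := isStabilizerCoset_iff.1 (hE T ⟨indep_permRel.1 hT, fun S hS => by
    refine Nat.le_of_mul_le_mul_left ?_ h.m_pos
    rw [hTc]
    exact h.bound S (indep_permRel.2 hS)⟩)
  exact ⟨i, v, _, fun f => (hmem f).trans (hgv _)⟩

lemma exists_apply_ne (hV : 2 ≤ Fintype.card V) (hG : MulAction.IsPretransitive G V) (v w : V) :
    ∃ g : G, (g : Perm V) v ≠ w := by
  have : Nontrivial V := Fintype.one_lt_card_iff_nontrivial.1 hV
  obtain ⟨u, hu⟩ := exists_ne w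
  obtain ⟨g, hg⟩ := hG.exists_smul_eq v u
  exact ⟨g, fun h => hu (hg.symm.trans h)⟩

/-- If `j ≠ i`, the coordinate `j` is free on the cylinder and, by transitivity, can be chosen to
move `v` away from `w`. -/
lemma index_eq_of_cylinder_subset (hV : 2 ≤ Fintype.card V) (hG : MulAction.IsPretransitive G V)
    {A : Finset G} (hA : A.Nonempty) {i j : Fin n} {v w : V}
    (h : ∀ f ∈ cylinder i A, (f j : Perm V) v = w) : j = i := by
  by_contra hne
  obtain ⟨a, ha⟩ := hA
  obtain ⟨g, hg⟩ := exists_apply_ne hV hG v w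
  refine hg ?_
  have := h (Function.update (fun _ => a) j g) (by
    rw [mem_cylinder, Function.update_of_ne (Ne.symm hne)]
    exact ha)
  simpa using this

lemma PowStrictEKR.card_mul_le (hG : MulAction.IsPretransitive G V)
    (hP : PowStrictEKR G n) {J : Finset (Fin n → G)} (hJ : Indep (powRel (permRel G) n) J) :
    Fintype.card V * #J ≤ Fintype.card (Fin n → G) := by
  obtain ⟨T, hT, hmax⟩ := exists_max_indep (powRel (permRel G) n)
  obtain ⟨i, v, w, hmem⟩ := hP T hT hmax
  have hTe : T = cylinder i (univ.filter fun x : G => (x : Perm V) v = w) := by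
    ext f
    simp [hmem]
  rw [← card_cylinder_tight (card_pointwise hG v w) i, ← hTe]
  exact Nat.mul_le_mul_left _ (hmax J hJ)

lemma PowStrictEKR.of_tight (hG : MulAction.IsPretransitive G V)
    (hP : PowStrictEKR G n) {J : Finset (Fin n → G)} (hJ : Indep (powRel (permRel G) n) J)
    (hJc : Fintype.card (Fin n → G) ≤ Fintype.card V * #J) :
    ∃ i v w, ∀ f, f ∈ J ↔ (f i : Perm V) v = w := by
  refine hP J hJ fun J' hJ' => ?_
  have h1 := hP.card_mul_le hG hJ'
  rcases Nat.eq_zero_or_pos (Fintype.card V) with h0 | h0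
  · have : 0 < Fintype.card (Fin n → G) := Fintype.card_pos
    rw [h0] at hJc
    omega
  · exact Nat.le_of_mul_le_mul_left (h1.trans hJc) h0

/-- The cylinder over a maximum intersecting set is maximum in the power; evaluating its description
on constant functions returns to `G`. -/
lemma PowStrictEKR.strictEKR (hV : 2 ≤ Fintype.card V) (hG : MulAction.IsPretransitive G V)
    (hn : 0 < n) (hP : PowStrictEKR G n) : StrictEKR G := by
  intro I ⟨hI, hmax⟩
  have hne : Nonempty V := Fintype.card_pos_iff.1 (by omega)
  obtain ⟨v₀⟩ := id hne
  have hIne : I.Nonempty := by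
    have := hmax {1} (indep_permRel.1 (indep_singleton_permRel 1))
    rw [card_singleton] at this
    exact card_pos.1 this
  obtain ⟨i, v, w, hmem⟩ := hP.of_tight hG ((indep_permRel.2 hI).cylinder ⟨0, hn⟩) (by
    rw [← card_cylinder_tight (card_pointwise hG v₀ v₀) ⟨0, hn⟩]
    refine Nat.mul_le_mul_left _ (Nat.le_of_mul_le_mul_right ?_ (Fintype.card_pos (α := G)))
    rw [card_cylinder, card_cylinder]
    exact Nat.mul_le_mul_right _ (hmax _ (indep_permRel.1 (indep_pointwise v₀ v₀))))
  obtain rfl := index_eq_of_cylinder_subset hV hG hIne fun f hf => (hmem f).1 hf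
  have hx : ∀ x, x ∈ I ↔ (x : Perm V) v = w := fun x => by
    simpa using hmem fun _ => x
  obtain ⟨g, hg⟩ := hIne
  exact isStabilizerCoset_iff.2 ⟨g, v, fun x => by rw [hx, (hx g).1 hg]⟩

lemma PowStrictEKR.primitive (hV : 2 ≤ Fintype.card V) (hG : MulAction.IsPretransitive G V)
    (hn : 2 ≤ n) (h : TightCayley (Fintype.card V) (permRel G)) (hP : PowStrictEKR G n) :
    Primitive (Fintype.card V) (permRel G) := by
  obtain ⟨k, rfl⟩ : ∃ k, n = k + 1 + 1 := ⟨n - 2, by omega⟩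
  intro A hA hne hAc
  obtain ⟨B, hB, hBc⟩ := h.tight
  -- The cylinder over `A` inherits the ratio `1 / m`: its neighbourhood lies in the cylinder over
  -- `N[A]`, and the averaged bound gives the other inequality.
  have hN : Fintype.card V * #(cylinder (0 : Fin (k + 1 + 1)) A) =
      #(nbhd (powRel (permRel G) (k + 1 + 1)) (cylinder 0 A)) := by
    refine le_antisymm ((h.pow (k + 1)).le_card_nbhd (hA.cylinder 0))
      ((card_le_card (nbhd_cylinder_subset _ A 0)).trans (le_of_eq ?_))
    refine Nat.eq_of_mul_eq_mul_right (Fintype.card_pos (α := G)) ?_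
    rw [card_cylinder, mul_assoc, card_cylinder, ← hAc, mul_assoc]
  have hc := (h.pow (k + 1)).exchange (hA.cylinder 0) hN (hB.cylinder 1)
    (card_cylinder_tight hBc 1)
  obtain ⟨i, v, w, hmem⟩ := hP.of_tight hG
    ((hA.cylinder 0).union_sdiff (h.pow (k + 1)).symm (hB.cylinder 1)) hc.ge
  -- The exchanged set contains the cylinder over `A`, so the coordinate that determines it is `0`.
  obtain rfl := index_eq_of_cylinder_subset hV hG hne fun f hf =>
    (hmem f).1 (mem_union_left _ hf)
  rw [hAc, card_eq_iff_eq_univ, eq_univ_iff_forall]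
  intro x
  -- Over `x ∉ N[A]` in coordinate `0`, membership in the exchanged set is decided by whether
  -- coordinate `1` lies in `B`. The choices `b ∈ B` and `c ∉ B` contradict dependence on coordinate
  -- `0` alone.
  by_contra hx
  obtain ⟨b, hb⟩ := nonempty_of_tight hBc
  obtain ⟨c, hcB⟩ := exists_notMem_of_tight hV hBc
  have h10 : (1 : Fin (k + 1 + 1)) ≠ 0 := by simp
  have hxv : (x : Perm V) v = w := by
    have := (hmem (Function.update (fun _ => b) 0 x)).1 (by
      refine mem_union_right _ (mem_sdiff.2 ⟨?_, fun hm => hx ?_⟩)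
      · rw [mem_cylinder, Function.update_of_ne h10]
        exact hb
      · simpa only [mem_cylinder, Function.update_self] using nbhd_cylinder_subset _ _ _ hm)
    simpa using this
  have hmc := (hmem (Function.update (fun _ => c) 0 x)).2 (by simpa using hxv)
  rcases mem_union.1 hmc with hm | hm
  · rw [mem_cylinder, Function.update_self] at hm
    exact hx (subset_nbhd hm)
  · have := (mem_sdiff.1 hm).1
    rw [mem_cylinder, Function.update_of_ne h10] at this
    exact hcB this

end Main

end PermEKR

theorem mainTheorem8 {V : Type*} [Fintype V] (hV : 3 ≤ Fintype.card V)
    (G : Subgroup (Equiv.Perm V)) (hG : MulAction.IsPretransitive G V)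
    (n : ℕ) (hn : 2 ≤ n) (H : Subgroup (Equiv.Perm (Fin n)))
    (hH : PermEKR.IsRegularPermGroup H) :
    PermEKR.StrictEKR (PermEKR.wreath G H) ↔
      (PermEKR.StrictEKR G ∧ PermEKR.ISPrimitive (PermEKR.derangementGraph G)) := by
  classical
  have hne : Nonempty V := Fintype.card_pos_iff.1 (by omega)
  rw [PermEKR.strictEKR_wreath_iff (by omega) hH]
  constructor
  · intro hP
    have hE := hP.strictEKR (by omega) hG (by omega)
    have hT := hE.tightCayley hG
    exact ⟨hE, (PermEKR.isPrimitive_iff hT).2 (hP.primitive (by omega) hG hn hT)⟩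
  · rintro ⟨hE, hI⟩
    have hT := hE.tightCayley hG
    exact PermEKR.powStrictEKR_of_primitive hV hE hT ((PermEKR.isPrimitive_iff hT).1 hI) (by omega)
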